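/- Let $R$ be a commutative unital ring that contains $\mathbb{Q}$ (that is, a commutative unital $\mathbb{Q}$-algebra) and carries a Hausdorff ring topology; for every $n$ give $M_n(R)$ the topology of entrywise convergence. For $G, X \in M_n(R)$ (and, with $n=1$, for $G,X\in R$) write $X = \exp G$ if the series $\sum_{k\ge 0} \frac{1}{k!}G^k$ converges unconditionally to $X$; then $X$ is called an exponential and $G$ a logarithm of $X$. A tuple $(x_1,\dots,x_k)\in R^k$ is unimodular if $x_1R+\dots+x_kR=R$, and a unimodular tuple $(x_1,\dots,x_{k+1})$ is reducible if there are $y_1,\dots,y_k\in R$ such that $(x_1+y_1x_{k+1},\dots,x_k+y_kx_{k+1})$ is unimodular. The Bass stable rank $\mathrm{bsr}(R)$ is the least integer $k\ge 1$ such that every unimodular tuple in $R^{k+1}$ is reducible, and $\mathrm{bsr}(R)=\infty$ if there is no such $k$. Suppose that $\mathrm{bsr}(R)=1$ and that every unit of $R$ has a logarithm in $R$. Then for every $n\ge 3$, every $X\in \mathrm{GL}_n(R)$ is a product of $6$ exponentials: there are $G_1,\dots,G_6\in M_n(R)$ such that $X=\exp G_1\,\exp G_2\cdots\exp G_6$.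 -/

import Mathlib

open scoped Nat MatrixGroups

/-- A tuple `(x₁, …, x_k) ∈ R^k` is unimodular if `x₁ R + ⋯ + x_k R = R`. -/
def IsUnimodular {R : Type*} [CommRing R] {k : ℕ} (x : Fin k → R) : Prop :=
  Ideal.span (Set.range x) = ⊤

/-- A tuple `(x₁, …, x_{k+1})` is reducible if there are `y₁, …, y_k ∈ R` such that
`(x₁ + y₁ x_{k+1}, …, x_k + y_k x_{k+1})` is unimodular. -/
def IsReducibleTuple {R : Type*} [CommRing R] {k : ℕ} (x : Fin (k + 1) → R) : Prop :=
  ∃ y : Fin k → R, IsUnimodular (fun i : Fin k => x i.castSucc + y i * x (Fin.last k))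

/-- The Bass stable rank: the least integer `k ≥ 1` such that every unimodular tuple of length
`k + 1` is reducible, and `⊤` if there is no such `k`. -/
noncomputable def bassStableRank (R : Type*) [CommRing R] : ℕ∞ :=
  sInf {r : ℕ∞ | ∃ k : ℕ, 1 ≤ k ∧ r = (k : ℕ∞) ∧
    ∀ x : Fin (k + 1) → R, IsUnimodular x → IsReducibleTuple x}

/-- `G` is a logarithm of `X`, that is, `exp G = X`: the exponential series `∑ G ^ k / k!`
converges and its sum is `X`. -/
def IsLogarithm {A : Type*} [Ring A] [Algebra ℚ A] [TopologicalSpace A] (G X : A) : Prop :=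
  HasSum (fun k : ℕ => ((k ! : ℚ)⁻¹) • G ^ k) X

/-- `X` is a product `exp G₁ ⋯ exp G_m` of `m` exponentials, in this order. -/
def IsProductOfExponentials {A : Type*} [Ring A] [Algebra ℚ A] [TopologicalSpace A]
    (m : ℕ) (X : A) : Prop :=
  ∃ G E : Fin m → A, (∀ j, IsLogarithm (G j) (E j)) ∧ X = (List.ofFn E).prod

/-- In a Hausdorff algebra, `IsLogarithm G X` determines `X` as the value at `G` of the usual
exponential function. -/
theorem IsLogarithm.exp_eq {A : Type*} [Ring A] [Algebra ℚ A] [TopologicalSpace A]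
    [IsTopologicalRing A] [T2Space A] {G X : A} (h : IsLogarithm G X) :
    NormedSpace.exp G = X := by
  rw [NormedSpace.exp_eq_tsum ℚ]
  exact h.tsum_eq

section NilpotentLogarithm

/-! Stable rank one lets a single column operation turn the corner of an invertible matrix into a
unit; clearing its row and column and inducting on the Schur complement gives X = L D Uᵀ L'
(`exists_lower_mul_diagonal_mul_upper_mul_lower`). The diagonal D has an entrywise logarithm, and
the unitriangular factors are unipotent, hence exponentials over ℚ
(`IsNilpotent.exists_exp_eq_one_add`). These are four exponentials; two factors exp 0 = 1 pad the
product to six. -/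

theorem IsNilpotent.exists_exp_eq_one_add_add_sq_mul {A : Type*} [CommRing A] [Algebra ℚ A]
    {z : A} (hz : IsNilpotent z) : ∃ w, IsNilpotent.exp z = 1 + z + z ^ 2 * w := by
  obtain ⟨k, hk⟩ := hz
  have hk2 : z ^ (k + 2) = 0 := by rw [pow_add, hk, zero_mul]
  refine ⟨∑ i ∈ Finset.range k, (((i + 2)! : ℕ) : ℚ)⁻¹ • z ^ i, ?_⟩
  rw [IsNilpotent.exp_eq_sum hk2, Finset.sum_range_succ', Finset.sum_range_succ', Finset.mul_sum]
  have h : ∀ i ∈ Finset.range k, (((i + 1 + 1)! : ℕ) : ℚ)⁻¹ • z ^ (i + 1 + 1) =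
      z ^ 2 * ((((i + 2)! : ℕ) : ℚ)⁻¹ • z ^ i) := fun i _ => by
    rw [mul_smul_comm, ← pow_add, add_comm 2 i]
  rw [Finset.sum_congr rfl h]
  simp
  ring

/-- Successive approximation of log(1 + x): multiplying by exp(-x^(k+1) q) cancels the error x^(k+1)
q up to order k + 2. Divisibility by x keeps every approximation nilpotent. -/
theorem IsNilpotent.exists_dvd_exp_eq_one_add_add_pow_mul {A : Type*} [CommRing A] [Algebra ℚ A]
    {x : A} (hx : IsNilpotent x) (k : ℕ) :
    ∃ y q, x ∣ y ∧ IsNilpotent.exp y = 1 + x + x ^ (k + 1) * q := by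
  induction k with
  | zero => exact ⟨0, -1, dvd_zero x, by simp [IsNilpotent.exp_zero]⟩
  | succ k ih =>
    obtain ⟨y, q, hxy, hy⟩ := ih
    have nil : ∀ {a : A}, x ∣ a → IsNilpotent a := fun ⟨c, hc⟩ =>
      hc ▸ (Commute.all x c).isNilpotent_mul_right hx
    have hxz : x ∣ -(x ^ (k + 1) * q) :=
      (Dvd.dvd.mul_right (dvd_pow_self x k.succ_ne_zero) q).neg_right
    obtain ⟨w, hw⟩ := (nil hxz).exists_exp_eq_one_add_add_sq_mul
    refine ⟨y + -(x ^ (k + 1) * q),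
      -q - x ^ k * q ^ 2 + x ^ k * q ^ 2 * w * (1 + x + x ^ (k + 1) * q), dvd_add hxy hxz, ?_⟩
    rw [IsNilpotent.exp_add_of_commute (Commute.all _ _) (nil hxy) (nil hxz), hy, hw]
    ring

/-- In a `ℚ`-algebra every unipotent element has a nilpotent logarithm. -/
theorem IsNilpotent.exists_exp_eq_one_add {A : Type*} [Ring A] [Algebra ℚ A] {x : A}
    (hx : IsNilpotent x) : ∃ y, IsNilpotent y ∧ IsNilpotent.exp y = 1 + x := by
  obtain ⟨n, hn⟩ := hx
  -- `A` need not be commutative, so the equation is solved in ℚ[X]/(X^n) and carried over by X ↦ x.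
  let P : Polynomial ℚ := Polynomial.X ^ n
  have hr : AdjoinRoot.root P ^ n = 0 := by
    simpa [P] using AdjoinRoot.eval₂_root P
  obtain ⟨y, q, hdvd, hy⟩ :=
    IsNilpotent.exists_dvd_exp_eq_one_add_add_pow_mul (x := AdjoinRoot.root P) ⟨n, hr⟩ n
  obtain ⟨c, rfl⟩ := hdvd
  have hnil : IsNilpotent (AdjoinRoot.root P * c) :=
    (Commute.all _ c).isNilpotent_mul_right ⟨n, hr⟩
  let f : AdjoinRoot P →ₐ[ℚ] A :=
    Ideal.Quotient.liftₐ (Ideal.span {P}) (Polynomial.aeval x) (fun a ha => by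
      obtain ⟨b, rfl⟩ := Ideal.mem_span_singleton.1 ha
      simp [P, hn])
  have hf : f (AdjoinRoot.root P) = x := Polynomial.aeval_X x
  refine ⟨f (AdjoinRoot.root P * c), hnil.map f, ?_⟩
  rw [← IsNilpotent.map_exp hnil f, hy, _root_.pow_succ, hr]
  simp [hf]

end NilpotentLogarithm

section Logarithms

theorem IsLogarithm.zero {A : Type*} [Ring A] [Algebra ℚ A] [TopologicalSpace A] :
    IsLogarithm (0 : A) 1 := by
  have h := hasSum_single (f := fun k : ℕ => ((k ! : ℚ)⁻¹) • (0 : A) ^ k) 0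
    (fun k hk => by simp [hk])
  simpa [IsLogarithm] using h

theorem IsNilpotent.isLogarithm {A : Type*} [Ring A] [Algebra ℚ A] [TopologicalSpace A] {y : A}
    (hy : IsNilpotent y) : IsLogarithm y (IsNilpotent.exp y) := by
  obtain ⟨k, hk⟩ := hy
  rw [IsNilpotent.exp_eq_sum hk]
  refine hasSum_sum_of_ne_finset_zero fun i hi => ?_
  rw [pow_eq_zero_of_le (by simpa using hi) hk, smul_zero]

theorem IsNilpotent.exists_isLogarithm_one_add {A : Type*} [Ring A] [Algebra ℚ A]
    [TopologicalSpace A] {x : A} (hx : IsNilpotent x) : ∃ G, IsLogarithm G (1 + x) := by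
  obtain ⟨y, hy, h⟩ := hx.exists_exp_eq_one_add
  exact ⟨y, h ▸ hy.isLogarithm⟩

theorem IsLogarithm.diagonal {R : Type*} [CommRing R] [Algebra ℚ R] [TopologicalSpace R]
    {m : Type*} [Fintype m] [DecidableEq m] {g d : m → R} (h : ∀ i, IsLogarithm (g i) (d i)) :
    IsLogarithm (Matrix.diagonal g) (Matrix.diagonal d) := by
  have h' := (Pi.hasSum.2 h).matrix_diagonal
  have hk : ∀ k : ℕ, ((k ! : ℚ)⁻¹) • Matrix.diagonal g ^ k =
      Matrix.diagonal fun i => ((k ! : ℚ)⁻¹) • g i ^ k := fun k => by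
    rw [Matrix.diagonal_pow, ← Matrix.diagonal_smul]
    rfl
  unfold IsLogarithm
  simp_rw [hk]
  exact h'

end Logarithms

section StableRank

theorem exists_isUnit_add_mul_of_bassStableRank_eq_one {R : Type*} [CommRing R]
    (h : bassStableRank R = 1) {a b : R} (hab : IsCoprime a b) : ∃ y, IsUnit (a + y * b) := by
  -- The infimum of an empty set would be ⊤; nonempty, it is attained, so k = 1 itself has the
  -- reduction property.
  have hne : {r : ℕ∞ | ∃ k : ℕ, 1 ≤ k ∧ r = (k : ℕ∞) ∧
      ∀ x : Fin (k + 1) → R, IsUnimodular x → IsReducibleTuple x}.Nonempty := by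
    rw [Set.nonempty_iff_ne_empty]
    intro h0
    rw [bassStableRank, h0, sInf_empty] at h
    exact ENat.top_ne_one h
  obtain ⟨k, -, hk, hred⟩ := csInf_mem hne
  rw [← bassStableRank, h] at hk
  obtain rfl : k = 1 := by exact_mod_cast hk.symm
  have hu : IsUnimodular ![a, b] := by
    rw [IsUnimodular, Ideal.eq_top_iff_one]
    obtain ⟨r, s, hrs⟩ := hab
    rw [← hrs]
    exact add_mem (Ideal.mul_mem_left _ _ (Ideal.subset_span ⟨0, rfl⟩))
      (Ideal.mul_mem_left _ _ (Ideal.subset_span ⟨1, rfl⟩))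
  obtain ⟨y, hy⟩ := hred _ hu
  refine ⟨y 0, ?_⟩
  rw [IsUnimodular, Set.range_unique, Ideal.span_singleton_eq_top] at hy
  simpa using hy

end StableRank

section TriangularFactorization

open Matrix

variable {R : Type*} {n : ℕ}

/-- The square matrix with corner `a`, remaining first row `r`, remaining first column `c` and
complementary block `M`. -/
def borderedMatrix (a : R) (r c : Fin n → R) (M : Matrix (Fin n) (Fin n) R) :
    Matrix (Fin (n + 1)) (Fin (n + 1)) R :=
  Fin.cons (Fin.cons a r) fun i => Fin.cons (c i) (M i)

@[simp] theorem borderedMatrix_zero_zero (a : R) (r c : Fin n → R) (M : Matrix (Fin n) (Fin n) R) :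
    borderedMatrix a r c M 0 0 = a := rfl

@[simp] theorem borderedMatrix_zero_succ (a : R) (r c : Fin n → R) (M : Matrix (Fin n) (Fin n) R)
    (j : Fin n) : borderedMatrix a r c M 0 j.succ = r j := rfl

@[simp] theorem borderedMatrix_succ_zero (a : R) (r c : Fin n → R) (M : Matrix (Fin n) (Fin n) R)
    (i : Fin n) : borderedMatrix a r c M i.succ 0 = c i := rfl

@[simp] theorem borderedMatrix_succ_succ (a : R) (r c : Fin n → R) (M : Matrix (Fin n) (Fin n) R)
    (i j : Fin n) : borderedMatrix a r c M i.succ j.succ = M i j := rfl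

theorem eq_borderedMatrix (X : Matrix (Fin (n + 1)) (Fin (n + 1)) R) :
    X = borderedMatrix (X 0 0) (fun j => X 0 j.succ) (fun i => X i.succ 0)
      (X.submatrix Fin.succ Fin.succ) := by
  ext i j
  cases i using Fin.cases <;> cases j using Fin.cases <;> simp

variable [CommRing R]

theorem borderedMatrix_mul (a a' : R) (r c r' c' : Fin n → R) (M M' : Matrix (Fin n) (Fin n) R) :
    borderedMatrix a r c M * borderedMatrix a' r' c' M' =
      borderedMatrix (a * a' + r ⬝ᵥ c') (a • r' + r ᵥ* M') (a' • c + M *ᵥ c')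
        (vecMulVec c r' + M * M') := by
  ext i j
  cases i using Fin.cases <;> cases j using Fin.cases <;>
    simp [Matrix.mul_apply, Fin.sum_univ_succ, dotProduct, vecMul, mulVec, vecMulVec_apply, mul_comm]

theorem borderedMatrix_one : borderedMatrix (1 : R) 0 0 (1 : Matrix (Fin n) (Fin n) R) = 1 := by
  ext i j
  cases i using Fin.cases <;> cases j using Fin.cases <;>
    simp [Matrix.one_apply, Fin.succ_ne_zero, (Fin.succ_ne_zero _).symm]

theorem borderedMatrix_diagonal (a : R) (d : Fin n → R) :
    borderedMatrix a 0 0 (diagonal d) = diagonal (Fin.cons a d) := by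
  ext i j
  cases i using Fin.cases <;> cases j using Fin.cases <;>
    simp [Matrix.diagonal_apply, Fin.succ_ne_zero, (Fin.succ_ne_zero _).symm]

/-- Lower triangular with ones on the diagonal. -/
def IsLowerUnitriangular (L : Matrix (Fin n) (Fin n) R) : Prop :=
  ∀ i j, i ≤ j → L i j = (1 : Matrix (Fin n) (Fin n) R) i j

theorem IsLowerUnitriangular.borderedMatrix {L : Matrix (Fin n) (Fin n) R}
    (hL : IsLowerUnitriangular L) (c : Fin n → R) :
    IsLowerUnitriangular (borderedMatrix 1 0 c L) := by
  intro i j hij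
  rw [← borderedMatrix_one]
  cases i using Fin.cases <;> cases j using Fin.cases <;> simp at hij ⊢
  exact hL _ _ hij

theorem IsLowerUnitriangular.isNilpotent_sub_one {L : Matrix (Fin n) (Fin n) R}
    (hL : IsLowerUnitriangular L) : IsNilpotent (L - 1) := by
  -- The k-th power is supported at least k places below the diagonal, which leaves no room when k =
  -- n.
  have key : ∀ k : ℕ, ∀ i j : Fin n, (i : ℕ) < j + k → ((L - 1) ^ k) i j = 0 := by
    intro k
    induction k with
    | zero =>
      intro i j hij
      rw [pow_zero, Matrix.one_apply_ne]
      exact ne_of_lt hij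
    | succ k ih =>
      intro i j hij
      rw [pow_succ, Matrix.mul_apply]
      refine Finset.sum_eq_zero fun l _ => ?_
      by_cases hlj : l ≤ j
      · rw [Matrix.sub_apply, hL l j hlj, sub_self, mul_zero]
      · rw [ih i l (by have : (j : ℕ) < l := not_le.1 hlj; omega), zero_mul]
  exact ⟨n, by ext i j; exact key n i j (by omega)⟩

theorem IsLowerUnitriangular.exists_isLogarithm [Algebra ℚ R] [TopologicalSpace R]
    {L : Matrix (Fin n) (Fin n) R} (hL : IsLowerUnitriangular L) : ∃ G, IsLogarithm G L := by
  simpa using hL.isNilpotent_sub_one.exists_isLogarithm_one_add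

theorem IsLowerUnitriangular.exists_isLogarithm_transpose [Algebra ℚ R] [TopologicalSpace R]
    {L : Matrix (Fin n) (Fin n) R} (hL : IsLowerUnitriangular L) : ∃ G, IsLogarithm G Lᵀ := by
  obtain ⟨G, hG⟩ := hL.exists_isLogarithm
  refine ⟨Gᵀ, ?_⟩
  have h := hG.matrix_transpose
  unfold IsLogarithm
  simpa [Matrix.transpose_smul, Matrix.transpose_pow] using h

/-- Over a ring of Bass stable rank one, every invertible matrix is a product of a lower
unitriangular, a diagonal, an upper unitriangular and a lower unitriangular matrix. -/
theorem exists_lower_mul_diagonal_mul_upper_mul_lower (h : bassStableRank R = 1)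
    (X : Matrix (Fin n) (Fin n) R) (hX : IsUnit X) :
    ∃ (L U L' : Matrix (Fin n) (Fin n) R) (d : Fin n → Rˣ),
      IsLowerUnitriangular L ∧ IsLowerUnitriangular U ∧ IsLowerUnitriangular L' ∧
        X = L * diagonal (fun i => (d i : R)) * Uᵀ * L' := by
  induction n with
  | zero => exact ⟨1, 1, 1, Fin.elim0, fun _ _ _ => rfl, fun _ _ _ => rfl, fun _ _ _ => rfl,
      Subsingleton.elim _ _⟩
  | succ n ih =>
    obtain ⟨Y, hXY⟩ := hX.exists_right_inv
    set a := X 0 0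
    set r : Fin n → R := fun j => X 0 j.succ
    set c : Fin n → R := fun i => X i.succ 0
    set M := X.submatrix Fin.succ Fin.succ
    have hXb : X = borderedMatrix a r c M := eq_borderedMatrix X
    -- The corner entry of X Y = 1 exhibits `a` and the product of `r` with the rest of Y's first
    -- column as coprime.
    obtain ⟨y, u, hu⟩ : ∃ y, IsUnit (a + y * (r ⬝ᵥ fun i => Y i.succ 0)) := by
      refine exists_isUnit_add_mul_of_bassStableRank_eq_one h ⟨Y 0 0, 1, ?_⟩
      have := congrFun (congrFun hXY 0) 0
      rw [Matrix.mul_apply, Fin.sum_univ_succ, Matrix.one_apply_eq] at this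
      rw [one_mul, mul_comm]
      exact this
    set v : Fin n → R := y • fun i => Y i.succ 0
    have hv : a + r ⬝ᵥ v = u := by rw [hu, dotProduct_smul, smul_eq_mul]
    set s : Fin n → R := (↑u⁻¹ : R) • r
    set t : Fin n → R := (↑u⁻¹ : R) • (c + M *ᵥ v)
    have hr : r = (u : R) • s := by simp [s, smul_smul]
    have ht : c + M *ᵥ v = (u : R) • t := by simp [t, smul_smul]
    -- Schur complement of the unit corner `u` in X after the column operation by `v`.
    set N := M - vecMulVec t r
    have hfac : X * borderedMatrix 1 0 v 1 =
        borderedMatrix 1 0 t 1 * (borderedMatrix (u : R) 0 0 N * borderedMatrix 1 s 0 1) := by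
      rw [hXb]
      simp only [borderedMatrix_mul]
      congr 1
      · simpa using hv
      · simpa using hr
      · simpa using ht
      · simp [N, ← hr]
    have hlow : ∀ w : Fin n → R, borderedMatrix 1 0 w 1 * borderedMatrix 1 0 (-w) 1 = 1 := by
      intro w
      simp [borderedMatrix_mul, borderedMatrix_one]
    have hunit : ∀ w : Fin n → R, IsUnit (borderedMatrix 1 0 w 1) := fun w =>
      IsUnit.of_mul_eq_one _ (hlow w)
    have hN : IsUnit N := by
      have h1 : IsUnit (borderedMatrix (u : R) 0 0 N * borderedMatrix 1 s 0 1) := by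
        rw [← (hunit t).mul_left_iff, ← hfac]
        exact hX.mul (hunit v)
      obtain ⟨Z, hZ⟩ := (isUnit_of_mul_isUnit_left h1).exists_right_inv
      rw [eq_borderedMatrix Z, borderedMatrix_mul, ← borderedMatrix_one] at hZ
      refine IsUnit.of_mul_eq_one (Z.submatrix Fin.succ Fin.succ) ?_
      ext i j
      simpa using congrFun (congrFun hZ i.succ) j.succ
    obtain ⟨L, U, L', d, hL, hU, hL', hNe⟩ := ih N hN
    obtain ⟨K, hK⟩ : ∃ K, L' * K = 1 := by
      have h1 := hL'.isNilpotent_sub_one.isUnit_one_add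
      rw [add_sub_cancel] at h1
      exact h1.exists_right_inv
    have hK' : K * L' = 1 := mul_eq_one_comm.1 hK
    -- Moving diag(1, L') to the right past the row `s` turns `s` into s K, with K = L'⁻¹; absorbing
    -- the inverse column operation into it turns -v into -L' v.
    refine ⟨borderedMatrix 1 0 t L, borderedMatrix 1 0 (s ᵥ* K) U,
      borderedMatrix 1 0 (-(L' *ᵥ v)) L', Fin.cons u d, hL.borderedMatrix _,
      hU.borderedMatrix _, hL'.borderedMatrix _, ?_⟩
    have hd : diagonal (fun i => ((Fin.cons u d : Fin (n + 1) → Rˣ) i : R)) =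
        borderedMatrix (u : R) 0 0 (diagonal fun i => (d i : R)) := by
      rw [borderedMatrix_diagonal]
      congr 1
      ext i
      cases i using Fin.cases <;> rfl
    have hUT : (borderedMatrix 1 0 (s ᵥ* K) U)ᵀ = borderedMatrix 1 (s ᵥ* K) 0 Uᵀ := by
      ext i j
      cases i using Fin.cases <;> cases j using Fin.cases <;> simp
    have hX' : X = X * borderedMatrix 1 0 v 1 * borderedMatrix 1 0 (-v) 1 := by
      rw [mul_assoc, hlow, mul_one]
    have hL'' : borderedMatrix 1 0 (-(L' *ᵥ v)) L' =
        borderedMatrix 1 0 0 L' * borderedMatrix 1 0 (-v) 1 := by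
      simp [borderedMatrix_mul, mulVec_neg]
    rw [hX', hfac, hd, hUT, hL'', ← mul_assoc _ (borderedMatrix 1 0 0 L')]
    congr 1
    simp [borderedMatrix_mul, hNe, vecMul_vecMul, hK', add_mul, vecMulVec_mul, mul_assoc, smul_vecMul]

end TriangularFactorization

theorem mainTheorem5 {R : Type*} [CommRing R] [Algebra ℚ R] [TopologicalSpace R]
    [IsTopologicalRing R] [T2Space R]
    (hbsr : bassStableRank R = 1)
    (hlog : ∀ x : Rˣ, ∃ y : R, IsLogarithm y (x : R))
    (n : ℕ) (hn : 3 ≤ n) (X : GL (Fin n) R) :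
    IsProductOfExponentials 6 (X : Matrix (Fin n) (Fin n) R) := by
  obtain ⟨L, U, L', d, hL, hU, hL', hX⟩ :=
    exists_lower_mul_diagonal_mul_upper_mul_lower hbsr (X : Matrix (Fin n) (Fin n) R) X.isUnit
  obtain ⟨G₁, h₁⟩ := hL.exists_isLogarithm
  choose g hg using fun i => hlog (d i)
  have h₂ := IsLogarithm.diagonal hg
  obtain ⟨G₃, h₃⟩ := hU.exists_isLogarithm_transpose
  obtain ⟨G₄, h₄⟩ := hL'.exists_isLogarithm
  refine ⟨![G₁, Matrix.diagonal g, G₃, G₄, 0, 0],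
    ![L, Matrix.diagonal fun i => (d i : R), U.transpose, L', 1, 1], ?_, ?_⟩
  · intro j
    fin_cases j
    exacts [h₁, h₂, h₃, h₄, IsLogarithm.zero, IsLogarithm.zero]
  · rw [hX]
    simp [List.ofFn_succ, mul_assoc]
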